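/- Let $R$ be a commutative ring with identity that is Bezout (every finitely generated ideal is principal) and semihereditary (every finitely generated ideal is a projective $R$-module). Call $a \in R$ a Gelfand element if for all $b, c \in R$ with $aR + bR + cR = R$ there exist $r, s \in R$ such that $a = rs$, $rR + bR = R$ and $sR + cR = R$. Suppose that every regular element (that is, every non-zero-divisor) of $R$ is a Gelfand element. Then $R$ is an elementary divisor ring: for every $n \times m$ matrix $A$ over $R$ there exist invertible matrices $P \in GL_n(R)$ and $Q \in GL_m(R)$ such that $PAQ = (d_{ij})$ is diagonal ($d_{ij} = 0$ for $i \ne j$) and $d_{ii}$ divides $d_{i+1,i+1}$ for all $i$ with $1 \le i < \min(n,m)$. -/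

import Mathlib

/-- A commutative ring is semihereditary if each of its finitely generated ideals is a
projective module. -/
def IsSemihereditaryRing (R : Type*) [CommRing R] : Prop :=
  ∀ I : Ideal R, I.FG → Module.Projective R I

/-- An element `a` is a Gelfand element if for all `b`, `c` with `aR + bR + cR = R` there is a
factorization `a = r * s` with `rR + bR = R` and `sR + cR = R`. -/
def IsGelfandElement {R : Type*} [CommRing R] (a : R) : Prop :=
  ∀ b c : R, Ideal.span {a, b, c} = ⊤ →
    ∃ r s : R, a = r * s ∧ Ideal.span {r, b} = ⊤ ∧ Ideal.span {s, c} = ⊤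

/-- A rectangular matrix is diagonal and each diagonal entry divides the next one. -/
def IsDivisorDiagonal {R : Type*} [CommRing R] {n m : ℕ} (D : Matrix (Fin n) (Fin m) R) : Prop :=
  (∀ (i : Fin n) (j : Fin m), (i : ℕ) ≠ (j : ℕ) → D i j = 0) ∧
  ∀ (k : ℕ) (hn : k + 1 < n) (hm : k + 1 < m),
    D ⟨k, Nat.lt_of_succ_lt hn⟩ ⟨k, Nat.lt_of_succ_lt hm⟩ ∣ D ⟨k + 1, hn⟩ ⟨k + 1, hm⟩

/-- A commutative ring is an elementary divisor ring if every rectangular matrix over it is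
equivalent to a diagonal matrix in which each diagonal entry divides the next one. -/
def IsElementaryDivisorRing (R : Type*) [CommRing R] : Prop :=
  ∀ (n m : ℕ) (A : Matrix (Fin n) (Fin m) R),
    ∃ (P : Matrix.GeneralLinearGroup (Fin n) R) (Q : Matrix.GeneralLinearGroup (Fin m) R),
      IsDivisorDiagonal ((P : Matrix (Fin n) (Fin n) R) * A * (Q : Matrix (Fin m) (Fin m) R))

/-!
A semihereditary ring is a p.p. ring: the annihilator of every element `a` is generated by an
idempotent `1 - e`, where `e * a = a`. Together with the Bezout property this makes `R` a Hermite
ring (`exists_factor_isCoprime`): every pair is a common divisor times a coprime pair, so every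
vector can be brought to the form `(g, 0, …, 0)` by an invertible matrix
(`exists_isUnit_vecMul_eq_single`).

The heart of the proof concerns a triangular matrix with rows `(a, b)` and `(0, c)`, where
`a, b, c` generate the unit ideal: there are vectors `x`, `y` on which the associated bilinear form
takes the value `1`. If `b` is a Gelfand element, write `b = r * s` with `r` coprime to `a` and `s`
coprime to `c`. From `s * p + c * k = 1` one gets `b * p + c * (r * k) = r`; dividing `p` and
`r * k` by their common divisor gives coprime `p₁`, `q₁` for which `b * p₁ + c * q₁` divides `r`,
so is coprime to `a`; and it is coprime to `p₁`, because `p₁` is coprime to `q₁` and to `c`. If `b`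
is a zero divisor, adding multiples of `a` and `c` replaces it by the regular element `b + (1 - e)`.

Going from triangular `2 × 2` matrices to two rows and then to any number of rows, one finds
for every matrix `A` vectors `x`, `y` such that `x ⬝ᵥ A *ᵥ y` divides all entries of `A`
(`exists_bilin_dvd`). By the Hermite property `x` and `y` can be taken to be a row and a column of
invertible matrices, so `A` is equivalent to a matrix whose corner entry divides all entries.
Clearing the first row and column and induction finish the proof.
-/

open Matrix

/-! ### Idempotents and the Hermite property -/

section CommRing

variable {R : Type*} [CommRing R]

/-- In a semihereditary ring the annihilator of an element is generated by an idempotent,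
written here as `1 - e`. -/
lemma IsSemihereditaryRing.exists_idempotent (hR : IsSemihereditaryRing R) (a : R) :
    ∃ e : R, e * e = e ∧ e * a = a ∧ ∀ x, x * a = 0 → x * e = 0 := by
  have hproj : Module.Projective R (Ideal.span {a}) := hR _ ⟨{a}, by simp⟩
  -- The surjection `R → aR`, `r ↦ r * a`, has a section; `e` is the image of `a` under it.
  let a' : Ideal.span {a} := ⟨a, Ideal.mem_span_singleton_self a⟩
  have hsurj : Function.Surjective (LinearMap.toSpanSingleton R (Ideal.span {a}) a') := by
    rintro ⟨y, hy⟩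
    obtain ⟨z, rfl⟩ := Ideal.mem_span_singleton'.1 hy
    exact ⟨z, rfl⟩
  obtain ⟨s, hs⟩ := Module.projective_lifting_property _ LinearMap.id hsurj
  have hea : s a' * a = a := congrArg Subtype.val (LinearMap.congr_fun hs a')
  have hann : ∀ x, x * a = 0 → x * s a' = 0 := fun x hx => by
    have h0 : x • a' = 0 := Subtype.ext hx
    have h1 := s.map_smul x a'
    rw [h0, map_zero] at h1
    exact h1.symm
  refine ⟨s a', ?_, hea, hann⟩
  have := hann (1 - s a') (by linear_combination -hea)
  linear_combination -this

/-- A semihereditary Bezout ring is a Hermite ring. -/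
lemma exists_factor_isCoprime [IsBezout R] (hR : IsSemihereditaryRing R) (a b : R) :
    ∃ d a₁ b₁ : R, a = d * a₁ ∧ b = d * b₁ ∧ IsCoprime a₁ b₁ := by
  obtain ⟨a', ha⟩ := IsBezout.gcd_dvd_left a b
  obtain ⟨b', hb⟩ := IsBezout.gcd_dvd_right a b
  obtain ⟨x, y, hxy⟩ := IsBezout.gcd_eq_sum a b
  generalize IsBezout.gcd a b = d at ha hb hxy
  obtain ⟨e, he, hed, hann⟩ := hR.exists_idempotent d
  -- `a' * x + b' * y` equals `1` on the component `e`; on `1 - e`, where `d` vanishes, the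
  -- cofactors may be chosen as `1` and `0`.
  have h := hann (1 - (a' * x + b' * y)) (by linear_combination -hxy + x * ha + y * hb)
  refine ⟨d, e * a' + (1 - e), e * b', by linear_combination ha - (a' - 1) * hed,
    by linear_combination hb - b' * hed, e * x + (1 - e), e * y, ?_⟩
  linear_combination (a' * x + b' * y - a' - x + 1) * he - h

/-! ### Triangular matrices of order two -/

/-- If `b` is a Gelfand element and `a, b, c` generate the unit ideal, then the bilinear form
with matrix rows `(a, b)`, `(0, c)` takes the value `1`. -/
lemma IsGelfandElement.exists_bilin_eq_one [IsBezout R] (hR : IsSemihereditaryRing R) {a b c : R}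
    (hb : IsGelfandElement b) (h : Ideal.span {b, a, c} = ⊤) :
    ∃ x₁ x₂ y₁ y₂ : R, x₁ * y₁ * a + x₁ * y₂ * b + x₂ * y₂ * c = 1 := by
  have hcop : ∀ {u v : R}, Ideal.span {u, v} = ⊤ → IsCoprime u v := fun huv =>
    Ideal.mem_span_pair.1 (huv ▸ Submodule.mem_top)
  obtain ⟨r, s, rfl, hra, hsc⟩ := hb a c h
  obtain ⟨p, k, hpk⟩ := hcop hsc
  obtain ⟨d, p₁, q₁, rfl, hq, hpq⟩ := exists_factor_isCoprime hR p (r * k)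
  have hr : d * (r * s * p₁ + q₁ * c) = r := by linear_combination r * hpk - c * hq
  have hwa : IsCoprime a (r * s * p₁ + q₁ * c) :=
    ((hcop hra).of_isCoprime_of_dvd_left (Dvd.intro_left _ hr)).symm
  have hpc : IsCoprime p₁ c := ⟨d * s, k, by linear_combination hpk⟩
  have hpw : IsCoprime p₁ (r * s * p₁ + q₁ * c) := by
    rw [add_comm]
    exact (hpq.mul_right hpc).add_mul_right_right _
  obtain ⟨y₁, y₂, hy⟩ := hpw.mul_left hwa
  exact ⟨p₁, q₁, y₁, y₂, by linear_combination hy⟩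

/-- Under the Gelfand hypothesis on regular elements, every triple `a, b, c` has a combination
of the shape of a value of the bilinear form with matrix rows `(a, b)`, `(0, c)` which divides
`a`, `b` and `c`. -/
lemma exists_bilin_dvd_triple [IsBezout R] (hR : IsSemihereditaryRing R)
    (hG : ∀ a ∈ nonZeroDivisors R, IsGelfandElement a) (a b c : R) :
    ∃ x₁ x₂ y₁ y₂ d : R, x₁ * y₁ * a + x₁ * y₂ * b + x₂ * y₂ * c = d ∧ d ∣ a ∧ d ∣ b ∧ d ∣ c := by
  obtain ⟨g, a₁, b₁, rfl, rfl, x, y, hxy⟩ := exists_factor_isCoprime hR a b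
  obtain ⟨d, g₁, c₁, rfl, rfl, z, w, hzw⟩ := exists_factor_isCoprime hR g c
  -- Dividing by `d` leaves the unimodular triple `g₁ * a₁, g₁ * b₁, c₁`.
  suffices ∃ x₁ x₂ y₁ y₂ : R,
      x₁ * y₁ * (g₁ * a₁) + x₁ * y₂ * (g₁ * b₁) + x₂ * y₂ * c₁ = 1 by
    obtain ⟨x₁, x₂, y₁, y₂, h⟩ := this
    exact ⟨x₁, x₂, y₁, y₂, d, by linear_combination d * h, ⟨g₁ * a₁, by ring⟩, ⟨g₁ * b₁, by ring⟩,
      ⟨c₁, rfl⟩⟩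
  have huni : z * x * (g₁ * a₁) + z * y * (g₁ * b₁) + w * c₁ = 1 := by
    linear_combination hzw + z * g₁ * hxy
  generalize g₁ * a₁ = a at huni ⊢
  generalize g₁ * b₁ = b at huni ⊢
  generalize c₁ = c at huni ⊢
  generalize z * x = u at huni
  generalize z * y = v at huni
  obtain ⟨e, he, heb, hann⟩ := hR.exists_idempotent b
  have hreg : b + (1 - e) ∈ nonZeroDivisors R := by
    rw [mem_nonZeroDivisors_iff_right]
    intro t ht
    have h1 : t * e = 0 := hann t (by linear_combination e * ht + t * he - t * heb)
    have h2 : t * b = 0 := by linear_combination b * h1 - t * heb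
    linear_combination ht - h2 + h1
  -- Since `(1 - e) * b = 0`, the element `1 - e` is a combination of `a` and `c`.
  have hcomb : b + (1 - e) = b + (1 - e) * u * a + (1 - e) * w * c := by
    linear_combination -v * heb - (1 - e) * huni
  have hspan : Ideal.span {b + (1 - e), a, c} = ⊤ := by
    rw [Ideal.eq_top_iff_one, Ideal.mem_span_insert']
    refine ⟨-v, ?_⟩
    rw [Ideal.mem_span_pair]
    refine ⟨u - v * ((1 - e) * u), w - v * ((1 - e) * w), ?_⟩
    linear_combination huni + v * hcomb
  obtain ⟨x₁, x₂, y₁, y₂, h⟩ := (hG _ hreg).exists_bilin_eq_one hR hspan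
  refine ⟨x₁, x₂ + (1 - e) * w * x₁, y₁ + (1 - e) * u * y₂, y₂, ?_⟩
  linear_combination h - x₁ * y₂ * hcomb

/-! ### Block matrices with a distinguished first row and column -/

/-- The matrix with corner entry `a`, remaining first row `x`, remaining first column `y` and
lower right block `A`. -/
def cornerBlock {n m : ℕ} (a : R) (x : Fin m → R) (y : Fin n → R) (A : Matrix (Fin n) (Fin m) R) :
    Matrix (Fin (n + 1)) (Fin (m + 1)) R :=
  Matrix.of (Fin.cons (Fin.cons a x) fun i => Fin.cons (y i) (A i))

section cornerBlock

variable {n m k : ℕ} (a : R) (x : Fin m → R) (y : Fin n → R) (A : Matrix (Fin n) (Fin m) R)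

omit [CommRing R] in
@[simp] lemma cornerBlock_zero_zero : cornerBlock a x y A 0 0 = a := rfl

omit [CommRing R] in
@[simp] lemma cornerBlock_zero_succ (j : Fin m) : cornerBlock a x y A 0 j.succ = x j := rfl

omit [CommRing R] in
@[simp] lemma cornerBlock_succ_zero (i : Fin n) : cornerBlock a x y A i.succ 0 = y i := rfl

omit [CommRing R] in
@[simp] lemma cornerBlock_succ_succ (i : Fin n) (j : Fin m) :
    cornerBlock a x y A i.succ j.succ = A i j := rfl

lemma cornerBlock_mul (b : R) (z : Fin k → R) (w : Fin m → R) (B : Matrix (Fin m) (Fin k) R) :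
    cornerBlock a x y A * cornerBlock b z w B =
      cornerBlock (a * b + x ⬝ᵥ w) (a • z + x ᵥ* B) (b • y + A *ᵥ w) (vecMulVec y z + A * B) := by
  ext i j
  cases i using Fin.cases <;> cases j using Fin.cases <;>
    simp [Matrix.mul_apply, Fin.sum_univ_succ, dotProduct, vecMul, mulVec, vecMulVec, mul_comm]

lemma cornerBlock_one : cornerBlock (1 : R) 0 0 (1 : Matrix (Fin n) (Fin n) R) = 1 := by
  ext i j
  cases i using Fin.cases <;> cases j using Fin.cases <;>
    simp [Matrix.one_apply, Fin.succ_ne_zero, (Fin.succ_ne_zero _).symm]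

lemma isUnit_cornerBlock_diag {Q : Matrix (Fin n) (Fin n) R} (hQ : IsUnit Q) :
    IsUnit (cornerBlock 1 0 0 Q) := by
  obtain ⟨Q', hQ'⟩ := hQ.exists_right_inv
  refine IsUnit.of_mul_eq_one (cornerBlock 1 0 0 Q') ?_
  simp [cornerBlock_mul, hQ', cornerBlock_one]

lemma isUnit_cornerBlock_row (x : Fin n → R) : IsUnit (cornerBlock 1 x 0 (1 : Matrix (Fin n) (Fin n) R)) := by
  refine IsUnit.of_mul_eq_one (cornerBlock 1 (-x) 0 1) ?_
  simp [cornerBlock_mul, cornerBlock_one]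

lemma isUnit_cornerBlock_col (y : Fin n → R) : IsUnit (cornerBlock 1 0 y (1 : Matrix (Fin n) (Fin n) R)) := by
  refine IsUnit.of_mul_eq_one (cornerBlock 1 0 (-y) 1) ?_
  simp [cornerBlock_mul, cornerBlock_one]

end cornerBlock

/-! ### Reduction of a single vector -/

/-- Over a semihereditary Bezout ring every row vector can be brought to the form
`(g, 0, …, 0)` by an invertible matrix. -/
lemma exists_isUnit_vecMul_eq_single [IsBezout R] (hR : IsSemihereditaryRing R) :
    ∀ {m : ℕ} (v : Fin (m + 1) → R),
      ∃ (Q : Matrix (Fin (m + 1)) (Fin (m + 1)) R) (g : R), IsUnit Q ∧ v ᵥ* Q = Pi.single 0 g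
  | 0, v => ⟨1, v 0, isUnit_one, by ext i; fin_cases i; simp⟩
  | m + 1, v => by
    obtain ⟨Q, b, hQ, hv⟩ := exists_isUnit_vecMul_eq_single hR (fun j => v j.succ)
    obtain ⟨g, a₁, b₁, ha, rfl, x, y, hxy⟩ := exists_factor_isCoprime hR (v 0) b
    -- `T` combines the first two coordinates, by a block of determinant `x * a₁ + y * b₁ = 1`.
    let T : Matrix (Fin (m + 2)) (Fin (m + 2)) R :=
      cornerBlock x (Pi.single 0 (-b₁)) (Pi.single 0 y) (cornerBlock a₁ 0 0 1)
    let T' : Matrix (Fin (m + 2)) (Fin (m + 2)) R :=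
      cornerBlock a₁ (Pi.single 0 b₁) (Pi.single 0 (-y)) (cornerBlock x 0 0 1)
    have hT : IsUnit T := by
      refine IsUnit.of_mul_eq_one T' ?_
      ext i j
      refine Fin.cases (Fin.cases ?_ (Fin.cases ?_ fun j => ?_) j)
        (Fin.cases (Fin.cases ?_ (Fin.cases ?_ fun j => ?_) j)
          fun i => Fin.cases ?_ (Fin.cases ?_ fun j => ?_) j) i <;>
      simp [T, T', Matrix.mul_apply, Fin.sum_univ_succ, Matrix.one_apply, Fin.succ_ne_zero,
        (Fin.succ_ne_zero _).symm, -Fin.succ_zero_eq_one, -Fin.succ_zero_eq_one']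
      · linear_combination hxy
      · ring
      · ring
      · linear_combination hxy
    refine ⟨cornerBlock 1 0 0 Q * T, g, (isUnit_cornerBlock_diag hQ).mul hT, ?_⟩
    have h1 : v ᵥ* cornerBlock 1 0 0 Q = Fin.cons (v 0) (Pi.single 0 (g * b₁)) := by
      rw [← hv]
      ext j
      cases j using Fin.cases <;> simp [vecMul, dotProduct, Fin.sum_univ_succ]
    rw [← vecMul_vecMul, h1, ha]
    ext j
    refine Fin.cases ?_ (Fin.cases ?_ fun j => ?_) j <;>
    simp [T, vecMul, dotProduct, Fin.sum_univ_succ, Fin.succ_ne_zero, -Fin.succ_zero_eq_one,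
      -Fin.succ_zero_eq_one']
    · linear_combination g * hxy
    · ring

/-- Every vector is a multiple of the first row of an invertible matrix. -/
lemma exists_isUnit_eq_smul_row [IsBezout R] (hR : IsSemihereditaryRing R) {m : ℕ}
    (v : Fin (m + 1) → R) :
    ∃ (P : Matrix (Fin (m + 1)) (Fin (m + 1)) R) (g : R), IsUnit P ∧ v = g • P 0 := by
  obtain ⟨Q, g, hQ, hv⟩ := exists_isUnit_vecMul_eq_single hR v
  obtain ⟨P, hQP⟩ := hQ.exists_right_inv
  refine ⟨P, g, IsUnit.of_mul_eq_one Q (mul_eq_one_comm.1 hQP), ?_⟩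
  have h := congrArg (· ᵥ* P) hv
  simp only [vecMul_vecMul, hQP, vecMul_one] at h
  rw [h]
  ext j
  simp [Matrix.vecMul, dotProduct, Pi.single_apply]

/-! ### A value of the bilinear form dividing all entries -/

lemma exists_dotProduct_dvd [IsBezout R] {m : ℕ} (v : Fin m → R) :
    ∃ z : Fin m → R, ∀ j, v ⬝ᵥ z ∣ v j := by
  have hfg : (Ideal.span (Set.range v)).FG := Submodule.fg_span (Set.finite_range v)
  obtain ⟨c, hc⟩ := (IsBezout.isPrincipal_of_FG _ hfg).principal
  have hmem : c ∈ Ideal.span (Set.range v) := hc ▸ Ideal.mem_span_singleton_self c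
  obtain ⟨z, rfl⟩ := (Ideal.mem_span_range_iff_exists_fun).1 hmem
  refine ⟨z, fun j => ?_⟩
  have : v j ∈ Ideal.span (Set.range v) := Ideal.subset_span ⟨j, rfl⟩
  rw [hc] at this
  simpa [dotProduct, mul_comm] using Ideal.mem_span_singleton.1 this

/-- If `d` divides the entries of `v ᵥ* Q` with `Q` invertible, then it divides those of `v`. -/
lemma dvd_of_dvd_vecMul {m : ℕ} {Q : Matrix (Fin m) (Fin m) R} (hQ : IsUnit Q) {d : R}
    {v : Fin m → R} (h : ∀ j, d ∣ (v ᵥ* Q) j) (j : Fin m) : d ∣ v j := by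
  obtain ⟨P, hP⟩ := hQ.exists_right_inv
  have hv : v = (v ᵥ* Q) ᵥ* P := by rw [vecMul_vecMul, hP, vecMul_one]
  rw [hv, vecMul, dotProduct]
  exact Finset.dvd_sum fun i _ => (h i).mul_right _

/-- The case of two rows, reduced to the triangular case by a change of basis. -/
lemma exists_bilin_dvd_pair [IsBezout R] (hR : IsSemihereditaryRing R)
    (hG : ∀ a ∈ nonZeroDivisors R, IsGelfandElement a) {m : ℕ} (v w : Fin m → R) :
    ∃ (s t : R) (y : Fin m → R), ∀ j,
      (s • v + t • w) ⬝ᵥ y ∣ v j ∧ (s • v + t • w) ⬝ᵥ y ∣ w j := by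
  cases m with
  | zero => exact ⟨0, 0, 0, fun j => j.elim0⟩
  | succ m =>
    obtain ⟨Q, g, hQ, hv⟩ := exists_isUnit_vecMul_eq_single hR v
    obtain ⟨z, hz⟩ := exists_dotProduct_dvd (fun j : Fin m => (w ᵥ* Q) j.succ)
    obtain ⟨t, s, y₂, y₁, d, hd, hdc, hdb, hdg⟩ := exists_bilin_dvd_triple hR hG
      ((fun j : Fin m => (w ᵥ* Q) j.succ) ⬝ᵥ z) ((w ᵥ* Q) 0) g
    refine ⟨s, t, Q *ᵥ Fin.cons y₁ (y₂ • z), ?_⟩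
    have hval : (s • v + t • w) ⬝ᵥ (Q *ᵥ Fin.cons y₁ (y₂ • z)) = d := by
      rw [dotProduct_mulVec, add_vecMul, smul_vecMul, smul_vecMul, hv, ← hd]
      simp only [dotProduct, Fin.sum_univ_succ]
      simp only [Finset.mul_sum, Pi.add_apply, Pi.smul_apply, smul_eq_mul, Pi.single_eq_same,
        Fin.cons_zero, Fin.cons_succ, Pi.single_eq_of_ne (Fin.succ_ne_zero _), mul_zero, zero_add]
      rw [add_assoc, add_comm]
      congr 1
      · exact Finset.sum_congr rfl fun i _ => by ring
      · ring
    rw [hval]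
    refine fun j => ⟨dvd_of_dvd_vecMul hQ (fun i => ?_) j, dvd_of_dvd_vecMul hQ (fun i => ?_) j⟩
    · rw [hv]
      cases i using Fin.cases <;> simp [hdg]
    · cases i using Fin.cases with
      | zero => exact hdb
      | succ i => exact hdc.trans (hz i)

/-- Every matrix admits a value of its bilinear form that divides all its entries. -/
lemma exists_bilin_dvd [IsBezout R] (hR : IsSemihereditaryRing R)
    (hG : ∀ a ∈ nonZeroDivisors R, IsGelfandElement a) {m : ℕ} :
    ∀ {n : ℕ} (A : Matrix (Fin n) (Fin m) R),
      ∃ (x : Fin n → R) (y : Fin m → R), ∀ i j, x ᵥ* A ⬝ᵥ y ∣ A i j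
  | 0, _ => ⟨0, 0, fun i => i.elim0⟩
  | n + 1, A => by
    obtain ⟨x, y, hxy⟩ := exists_bilin_dvd hR hG (A.submatrix Fin.succ id)
    -- The combination `x` of the lower rows already carries their common divisor, so that only
    -- two rows remain.
    obtain ⟨s, t, z, hz⟩ := exists_bilin_dvd_pair hR hG (A 0) (x ᵥ* A.submatrix Fin.succ id)
    have hrow : Fin.cons s (t • x) ᵥ* A = s • A 0 + t • (x ᵥ* A.submatrix Fin.succ id) := by
      ext j
      simp [vecMul, dotProduct, Fin.sum_univ_succ, Finset.mul_sum, mul_assoc]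
    refine ⟨Fin.cons s (t • x), z, fun i j => ?_⟩
    rw [hrow]
    cases i using Fin.cases with
    | zero => exact (hz j).1
    | succ i =>
      refine dvd_trans ?_ (hxy i j)
      exact Finset.dvd_sum fun l _ => (hz l).2.mul_right _

/-! ### Diagonal reduction -/

lemma dvd_mul_mul_apply {n m : ℕ} {d : R} {A : Matrix (Fin n) (Fin m) R} (h : ∀ i j, d ∣ A i j)
    (P : Matrix (Fin n) (Fin n) R) (Q : Matrix (Fin m) (Fin m) R) (i : Fin n) (j : Fin m) :
    d ∣ (P * A * Q) i j := by
  simp only [Matrix.mul_apply]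
  exact Finset.dvd_sum fun l _ =>
    (Finset.dvd_sum fun l' _ => (h l' l).mul_left (P i l')).mul_right (Q l j)

/-- Every nonempty matrix is equivalent to one whose corner entry divides all entries and is
alone in its row and column. -/
lemma exists_equiv_cornerBlock [IsBezout R] (hR : IsSemihereditaryRing R)
    (hG : ∀ a ∈ nonZeroDivisors R, IsGelfandElement a) {n m : ℕ}
    (A : Matrix (Fin (n + 1)) (Fin (m + 1)) R) :
    ∃ (P : Matrix (Fin (n + 1)) (Fin (n + 1)) R) (Q : Matrix (Fin (m + 1)) (Fin (m + 1)) R)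
      (d : R) (B : Matrix (Fin n) (Fin m) R), IsUnit P ∧ IsUnit Q ∧
        P * A * Q = cornerBlock d 0 0 B ∧ ∀ i j, d ∣ B i j := by
  obtain ⟨x, y, hxy⟩ := exists_bilin_dvd hR hG A
  obtain ⟨P, g, hP, rfl⟩ := exists_isUnit_eq_smul_row hR x
  obtain ⟨Q, h, hQ, rfl⟩ := exists_isUnit_eq_smul_row hR y
  have hcorner : (P * A * Qᵀ) 0 0 = P 0 ᵥ* A ⬝ᵥ Q 0 := by
    simp [Matrix.mul_apply, dotProduct, vecMul]
  have hA : ∀ i j, (P * A * Qᵀ) 0 0 ∣ A i j := fun i j => by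
    refine dvd_trans ?_ (hxy i j)
    rw [hcorner, smul_vecMul, smul_dotProduct, dotProduct_smul]
    exact ⟨g * h, by simp only [smul_eq_mul]; ring⟩
  have hM : ∀ i j, (P * A * Qᵀ) 0 0 ∣ (P * A * Qᵀ) i j :=
    dvd_mul_mul_apply hA P Qᵀ
  generalize hMdef : P * A * Qᵀ = M at hM
  choose c hc using hM
  refine ⟨cornerBlock 1 0 (fun i => -c i.succ 0) 1 * P,
    Qᵀ * cornerBlock 1 (fun j => -c 0 j.succ) 0 1,
    M 0 0, Matrix.of fun i j => M i.succ j.succ - M 0 0 * (c i.succ 0 * c 0 j.succ),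
    (isUnit_cornerBlock_col _).mul hP, ((isUnit_transpose Q).2 hQ).mul (isUnit_cornerBlock_row _),
    ?_, fun i j => dvd_sub (Dvd.intro _ (hc _ _).symm) (Dvd.intro _ rfl)⟩
  have hassoc : ∀ (L : Matrix (Fin (n + 1)) (Fin (n + 1)) R)
      (N : Matrix (Fin (m + 1)) (Fin (m + 1)) R), L * P * A * (Qᵀ * N) = L * M * N := fun L N => by
    rw [← hMdef]; simp only [Matrix.mul_assoc]
  rw [hassoc]
  ext i j
  cases i using Fin.cases <;> cases j using Fin.cases <;>
    simp [Matrix.mul_apply, Fin.sum_univ_succ, Matrix.one_apply]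
  · linear_combination hc 0 _
  · linear_combination hc (Fin.succ _) 0
  · linear_combination -c 0 (Fin.succ _) * hc (Fin.succ _) 0 - c (Fin.succ _) 0 * hc 0 (Fin.succ _)
end CommRing

theorem theorem22 {R : Type*} [CommRing R] [IsBezout R] (hR : IsSemihereditaryRing R)
    (hG : ∀ a ∈ nonZeroDivisors R, IsGelfandElement a) :
    IsElementaryDivisorRing R := by
  suffices ∀ (n m : ℕ) (A : Matrix (Fin n) (Fin m) R),
      ∃ (P : Matrix (Fin n) (Fin n) R) (Q : Matrix (Fin m) (Fin m) R),
        IsUnit P ∧ IsUnit Q ∧ IsDivisorDiagonal (P * A * Q) by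
    intro n m A
    obtain ⟨P, Q, ⟨P, rfl⟩, ⟨Q, rfl⟩, h⟩ := this n m A
    exact ⟨P, Q, h⟩
  intro n
  induction n with
  | zero => exact fun m A => ⟨1, 1, isUnit_one, isUnit_one, fun i => i.elim0, fun k hn => by omega⟩
  | succ n ih =>
    rintro (_ | m) A
    · exact ⟨1, 1, isUnit_one, isUnit_one, fun _ j => j.elim0, fun k _ hm => by omega⟩
    obtain ⟨P, Q, d, B, hP, hQ, hPQ, hd⟩ := exists_equiv_cornerBlock hR hG A
    obtain ⟨P', Q', hP', hQ', hdiag, hdvd⟩ := ih m B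
    have hprod : cornerBlock 1 0 0 P' * P * A * (Q * cornerBlock 1 0 0 Q') =
        cornerBlock d 0 0 (P' * B * Q') := by
      rw [show cornerBlock 1 0 0 P' * P * A * (Q * cornerBlock 1 0 0 Q') =
        cornerBlock 1 0 0 P' * (P * A * Q) * cornerBlock 1 0 0 Q' by simp only [Matrix.mul_assoc],
        hPQ]
      simp [cornerBlock_mul]
    refine ⟨_, _, (isUnit_cornerBlock_diag hP').mul hP, hQ.mul (isUnit_cornerBlock_diag hQ'), ?_⟩
    rw [hprod]
    refine ⟨fun i j hij => ?_, fun k hn hm => ?_⟩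
    · cases i using Fin.cases <;> cases j using Fin.cases
      · exact absurd rfl hij
      · rfl
      · rfl
      · exact hdiag _ _ fun h => hij (by simpa using h)
    · cases k with
      | zero =>
        -- The first divisibility holds because `d` divides every entry of `P' * B * Q'`.
        change d ∣ (P' * B * Q') ⟨0, _⟩ ⟨0, _⟩
        exact dvd_mul_mul_apply hd P' Q' _ _
      | succ k => exact hdvd k (by omega) (by omega)
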